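/- **Setting.** Let $X$ be a Banach space, let $A$ be the generator of a strongly continuous semigroup $T$ of bounded linear operators on $X$, let $U$ be a normed linear space and let $f:X\times U\to X$. Let $\mathcal U:=PC(\mathbb R_+,U)$ be the space of globally bounded, right-continuous, piecewise continuous functions $u:\mathbb R_+\to U$ (finitely many discontinuities on every compact interval, with one-sided limits there), with $\|u\|_{\mathcal U}:=\sup_{t\ge 0}\|u(t)\|_U$. Consider $$\dot x(t)=Ax(t)+f(x(t),u(t)),\qquad u\in\mathcal U, \tag{1}$$ in the sense of mild solutions, i.e. continuous $x:\mathbb R_+\to X$ with $x(t)=T(t)x(0)+\int_0^tT(t-s)f(x(s),u(s))\,ds$ for all $t\ge0$. Assume that for all $x\in X$ and $u\in\mathcal U$ there is a unique mild solution on $\mathbb R_+$ with $x(0)=x$, and denote it by $t\mapsto\phi(t,x,u)$. **Notions.** For nonempty $\mathcal A\subset X$ put $\|x\|_{\mathcal A}:=\inf_{y\in\mathcal A}\|x-y\|$. $\mathcal K$ is the set of continuous strictly increasing $\gamma:\mathbb R_+\to\mathbb R_+$ with $\gamma(0)=0$; $\mathcal K_\infty$ is the set of unbounded $\gamma\in\mathcal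 K$; $\mathcal L$ is the set of continuous strictly decreasing $\gamma:\mathbb R_+\to\mathbb R_+$ with $\gamma(t)\to0$ as $t\to\infty$; $\mathcal{KL}$ is the set of continuous $\beta:\mathbb R_+\times\mathbb R_+\to\mathbb R_+$ with $\beta(\cdot,t)\in\mathcal K$ for all $t\ge0$ and $\beta(r,\cdot)\in\mathcal L$ for all $r>0$. The system (1) * has *bounded reachability sets* (BRS) if $\sup\{\|\phi(t,x,u)\|:\|x\|\le C,\ \|u\|_{\mathcal U}\le C,\ t\in[0,\tau]\}<\infty$ for all $C,\tau>0$; * is *ISpS with respect to $\mathcal A$* if there are $\beta\in\mathcal{KL}$, $\gamma\in\mathcal K_\infty$, $c>0$ with $\|\phi(t,x,u)\|_{\mathcal A}\le\beta(\|x\|_{\mathcal A},t)+\gamma(\|u\|_{\mathcal U})+c$ for all $x\in X$, $u\in\mathcal U$, $t\ge0$; it is *ISS with respect to $\mathcal A$* if this holds with $c=0$; it is *ISpS* if it is ISpS with respect to some nonempty bounded $\mathcal A\subset X$; * is *ULIM with respect to $\mathcal A$* if there is $\gamma\in\mathcal K_\infty$ such that for all $\varepsilon,r>0$ there is $\tau=\tau(\varepsilon,r)<\infty$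 such that for all $u\in\mathcal U$ and all $x$ with $\|x\|_{\mathcal A}\le r$ there is $t\in[0,\tau]$ with $\|\phi(t,x,u)\|_{\mathcal A}\le\varepsilon+\gamma(\|u\|_{\mathcal U})$. A set $\mathcal A$ is *$s$-invariant* if $\phi(t,x,u)\in\mathcal A$ for all $t\ge0$, $x\in\mathcal A$ and $u\in\mathcal U$ with $\|u\|_{\mathcal U}\le s$. **Proposition.** Assume that (1) is BRS, that $f$ is Lipschitz continuous on bounded subsets of $X$ (for every $C>0$ there is $L>0$ such that $\|f(x,v)-f(y,v)\|\le L\|x-y\|$ whenever $\|x\|,\|y\|,\|v\|_U\le C$), and that $f(x,\cdot)$ is continuous for every $x\in X$. Then the following statements are equivalent: 1. (1) is ISpS; 2. for every $s>0$ there is a nonempty bounded $s$-invariant set $\mathcal A\subset X$ such that (1) is ISS with respect to $\mathcal A$; 3. there is a nonempty bounded set $\mathcal A\subset X$ such that (1) is ULIM with respect to $\mathcal A$. -/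

import Mathlib

open Set Filter Topology MeasureTheory
open scoped NNReal

/-! ### Comparison functions

Functions `ℝ₊ → ℝ₊` are represented by functions on `ℝ` of which only the restriction to
`[0, ∞)` is constrained and used. -/

/-- Class `K`: continuous, strictly increasing, zero at zero. -/
structure IsClassK (γ : ℝ → ℝ) : Prop where
  continuousOn : ContinuousOn γ (Ici 0)
  strictMonoOn : StrictMonoOn γ (Ici 0)
  map_zero : γ 0 = 0

/-- Class `K∞`: the unbounded functions of class `K`. -/
structure IsClassKInf (γ : ℝ → ℝ) : Prop extends IsClassK γ where
  unbounded : ¬ BddAbove (γ '' Ici 0)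

/-- Class `L`: continuous, strictly decreasing, with limit zero at infinity
(hence positive on `[0, ∞)`). -/
structure IsClassL (γ : ℝ → ℝ) : Prop where
  continuousOn : ContinuousOn γ (Ici 0)
  strictAntiOn : StrictAntiOn γ (Ici 0)
  tendsto_zero : Tendsto γ atTop (𝓝 0)

/-- Class `KL`. -/
structure IsClassKL (β : ℝ → ℝ → ℝ) : Prop where
  continuousOn : ContinuousOn (fun p : ℝ × ℝ => β p.1 p.2) (Ici 0 ×ˢ Ici 0)
  classK : ∀ t, 0 ≤ t → IsClassK (fun r => β r t)
  classL : ∀ r, 0 < r → IsClassL (β r)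

/-! ### Stability notions

The notions are defined for a transition map `φ t x u` on a normed space `X`, with inputs `u`
in a space `V` that carries a norm. The distance `‖x‖_A` of `x` to a nonempty set `A` is
`Metric.infDist x A`. -/

section Stability

variable {X V : Type*} [NormedAddCommGroup X] [Norm V]

/-- `A` is `s`-invariant: trajectories that start in `A`, with inputs of norm at most `s`,
stay in `A`. -/
def IsSInvariant (φ : ℝ≥0 → X → V → X) (s : ℝ) (A : Set X) : Prop :=
  ∀ (t : ℝ≥0) (x : X) (u : V), x ∈ A → ‖u‖ ≤ s → φ t x u ∈ A

/-- Input-to-state practical stability with respect to `A`. -/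
def IsISpSWrt (φ : ℝ≥0 → X → V → X) (A : Set X) : Prop :=
  ∃ β γ c, IsClassKL β ∧ IsClassKInf γ ∧ 0 < c ∧ ∀ (x : X) (u : V) (t : ℝ≥0),
    Metric.infDist (φ t x u) A ≤ β (Metric.infDist x A) t + γ ‖u‖ + c

/-- Input-to-state stability with respect to `A`. -/
def IsISSWrt (φ : ℝ≥0 → X → V → X) (A : Set X) : Prop :=
  ∃ β γ, IsClassKL β ∧ IsClassKInf γ ∧ ∀ (x : X) (u : V) (t : ℝ≥0),
    Metric.infDist (φ t x u) A ≤ β (Metric.infDist x A) t + γ ‖u‖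

/-- Input-to-state practical stability: with respect to some nonempty bounded set. -/
def IsISpS (φ : ℝ≥0 → X → V → X) : Prop :=
  ∃ A : Set X, A.Nonempty ∧ Bornology.IsBounded A ∧ IsISpSWrt φ A

/-- The uniform limit property with respect to `A`. -/
def IsULIMWrt (φ : ℝ≥0 → X → V → X) (A : Set X) : Prop :=
  ∃ γ, IsClassKInf γ ∧ ∀ ε r : ℝ, 0 < ε → 0 < r → ∃ τ : ℝ≥0, ∀ (u : V) (x : X),
    Metric.infDist x A ≤ r → ∃ t ≤ τ, Metric.infDist (φ t x u) A ≤ ε + γ ‖u‖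

/-- Bounded reachability sets (in finite time). -/
def HasBRS (φ : ℝ≥0 → X → V → X) : Prop :=
  ∀ (C : ℝ) (τ : ℝ≥0), 0 < C → 0 < τ → ∃ M : ℝ, ∀ (x : X) (u : V) (t : ℝ≥0),
    ‖x‖ ≤ C → ‖u‖ ≤ C → t ≤ τ → ‖φ t x u‖ ≤ M

end Stability

/-! ### Piecewise continuous inputs -/

/-- The space `PC(ℝ₊, U)` of bounded, right-continuous, piecewise continuous functions:
finitely many discontinuities on every compact interval, with one-sided limits there. -/
structure PCInput (U : Type*) [NormedAddCommGroup U] where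
  toFun : ℝ≥0 → U
  bounded' : ∃ M : ℝ, ∀ t, ‖toFun t‖ ≤ M
  rightContinuous' : ∀ t, ContinuousWithinAt toFun (Ici t) t
  leftLimit' : ∀ t, ∃ l, Tendsto toFun (𝓝[<] t) (𝓝 l)
  finite_discontinuities' : ∀ τ, {t | t ≤ τ ∧ ¬ ContinuousAt toFun t}.Finite

instance {U : Type*} [NormedAddCommGroup U] : CoeFun (PCInput U) (fun _ => ℝ≥0 → U) :=
  ⟨PCInput.toFun⟩

/-- The supremum norm on `PC(ℝ₊, U)`. -/
noncomputable instance {U : Type*} [NormedAddCommGroup U] : Norm (PCInput U) :=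
  ⟨fun u => ⨆ t, ‖u t‖⟩

/-! ### Strongly continuous semigroups and mild solutions -/

/-- A strongly continuous semigroup of bounded linear operators. -/
structure C0Semigroup (X : Type*) [NormedAddCommGroup X] [NormedSpace ℝ X] where
  toFun : ℝ≥0 → X →L[ℝ] X
  map_zero' : toFun 0 = ContinuousLinearMap.id ℝ X
  map_add' : ∀ s t, toFun (s + t) = (toFun s).comp (toFun t)
  continuous' : ∀ x, Continuous (fun t => toFun t x)

instance {X : Type*} [NormedAddCommGroup X] [NormedSpace ℝ X] :
    CoeFun (C0Semigroup X) (fun _ => ℝ≥0 → X →L[ℝ] X) := ⟨C0Semigroup.toFun⟩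

section Evolution

variable {X U : Type*} [NormedAddCommGroup X] [NormedSpace ℝ X] [NormedAddCommGroup U]

/-- `A`, with domain `A.domain`, is the generator of `T`: `x ∈ D(A)` and `A x = y` if and only
if the difference quotients `(T(h) x - x) / h` converge to `y` as `h → 0+`. -/
def C0Semigroup.IsGenerator (T : C0Semigroup X) (A : X →ₗ.[ℝ] X) : Prop :=
  ∀ x y : X, (x, y) ∈ A.graph ↔
    Tendsto (fun h : ℝ≥0 => (h : ℝ)⁻¹ • (T h x - x)) (𝓝[>] 0) (𝓝 y)

/-- `x : ℝ₊ → X` is a mild solution on `ℝ₊` of `x' = A x + f(x, u)`, `x(0) = x₀`, where `A`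
generates `T`. -/
structure IsMildSolution (T : C0Semigroup X) (f : X → U → X) (x₀ : X) (u : PCInput U)
    (x : ℝ≥0 → X) : Prop where
  continuous : Continuous x
  initial : x 0 = x₀
  integrable : ∀ t : ℝ≥0, IntervalIntegrable
    (fun s : ℝ => T (t - s).toNNReal (f (x s.toNNReal) (u s.toNNReal))) volume 0 t
  integral_eq : ∀ t : ℝ≥0,
    x t = T t (x 0) + ∫ s in (0 : ℝ)..t, T (t - s).toNNReal (f (x s.toNNReal) (u s.toNNReal))

/-- The system is forward complete, with transition map `φ`: for all `x` and `u`, the function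
`t ↦ φ t x u` is the unique mild solution on `ℝ₊` with initial value `x` and input `u`. -/
def IsMildFlow (T : C0Semigroup X) (f : X → U → X) (φ : ℝ≥0 → X → PCInput U → X) : Prop :=
  ∀ (x : X) (u : PCInput U), IsMildSolution T f x u (fun t => φ t x u) ∧
    ∀ y, IsMildSolution T f x u y → y = fun t => φ t x u

/-- `f` is Lipschitz continuous in `x` on bounded subsets of `X`, uniformly for `v` in bounded
subsets of `U`. -/
def LipschitzOnBounded (f : X → U → X) : Prop :=
  ∀ C : ℝ, 0 < C → ∃ L : ℝ, 0 < L ∧ ∀ (x y : X) (v : U),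
    ‖x‖ ≤ C → ‖y‖ ≤ C → ‖v‖ ≤ C → ‖f x v - f y v‖ ≤ L * ‖x - y‖

end Evolution

/-! ### Operations on inputs -/

namespace PCInput

variable {U : Type*} [NormedAddCommGroup U]

/-! Statement 2 with `s = 1` contains statement 1. From 1 to 3, thickening the set by the offset `c`
absorbs that offset, and the decay of `β` gives uniform hitting times.

The substance is 3 → 2. By ULIM, trajectories with inputs bounded by `s` visit a bounded
neighbourhood `D s` of the given set, from any ball within uniform time. The set `B s` of all points
reachable from `D s` with such inputs is `s`-invariant by concatenation of inputs. It is bounded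
because each excursion from `D s` returns within a fixed time, and BRS controls the motion in
between. It absorbs every ball after a time independent of the input (`exists_absorbing`).

ISS with respect to `B s` then has three regimes. For inputs of norm at most `s`, Lipschitz
dependence on the initial value (`exists_lipschitz`) and invariance bound the distance to `B s`
linearly until it vanishes. For larger inputs, the distance is merely bounded; being above `s`,
either the input norm or the initial distance turns this bound into a linear one.
`exists_isClassKInf_of_le_mul` converts such local linear bounds into comparison functions. -/

theorem toFun_injective : Function.Injective (toFun : PCInput U → ℝ≥0 → U) := by
  rintro ⟨_, _, _, _, _⟩ ⟨_, _, _, _, _⟩ h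
  cases h
  rfl

theorem norm_apply_le (u : PCInput U) (t : ℝ≥0) : ‖u t‖ ≤ ‖u‖ := by
  obtain ⟨M, hM⟩ := u.bounded'
  exact le_ciSup (f := fun t => ‖u t‖) ⟨M, by rintro _ ⟨t, rfl⟩; exact hM t⟩ t

theorem norm_le_iff (u : PCInput U) (s : ℝ) : ‖u‖ ≤ s ↔ ∀ t, ‖u t‖ ≤ s :=
  ⟨fun h t => (u.norm_apply_le t).trans h, fun h => ciSup_le h⟩

theorem norm_nonneg (u : PCInput U) : 0 ≤ ‖u‖ :=
  (_root_.norm_nonneg _).trans (u.norm_apply_le 0)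

/-- The zero input. -/
def zero : PCInput U where
  toFun _ := 0
  bounded' := ⟨0, by simp⟩
  rightContinuous' _ := continuousWithinAt_const
  leftLimit' _ := ⟨0, tendsto_const_nhds⟩
  finite_discontinuities' _ := by simp [continuousAt_const]

/-- The input `u(· + τ)`. -/
def shift (τ : ℝ≥0) (u : PCInput U) : PCInput U where
  toFun t := u (t + τ)
  bounded' := u.bounded'.imp fun _ hM t => hM _
  rightContinuous' t := (u.rightContinuous' (t + τ)).comp (f := fun r => r + τ)
    (by fun_prop) fun r (hr : t ≤ r) => by simpa using hr
  leftLimit' t := by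
    obtain ⟨l, hl⟩ := u.leftLimit' (t + τ)
    refine ⟨l, hl.comp (tendsto_nhdsWithin_iff.2 ⟨?_, ?_⟩)⟩
    · exact (show Continuous fun r : ℝ≥0 => r + τ by fun_prop).continuousWithinAt
    · filter_upwards [self_mem_nhdsWithin] with r hr
      simpa using hr
  finite_discontinuities' T := by
    refine ((u.finite_discontinuities' (T + τ)).preimage
      (f := fun r => r + τ) (add_left_injective τ).injOn).subset ?_
    rintro t ⟨ht, hc⟩
    exact ⟨by simpa using ht, fun h => hc (h.comp (f := fun r => r + τ) (by fun_prop))⟩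

theorem norm_shift_le (τ : ℝ≥0) (u : PCInput U) : ‖u.shift τ‖ ≤ ‖u‖ :=
  (norm_le_iff _ _).2 fun t => u.norm_apply_le (t + τ)

/-- The input equal to `u` on `[0, τ)` and to `v(· - τ)` on `[τ, ∞)`. -/
noncomputable def concat (τ : ℝ≥0) (u v : PCInput U) : PCInput U where
  toFun t := if t < τ then u t else v (t - τ)
  bounded' := ⟨max ‖u‖ ‖v‖, fun t => by
    split_ifs
    · exact (u.norm_apply_le _).trans (le_max_left _ _)
    · exact (v.norm_apply_le _).trans (le_max_right _ _)⟩
  rightContinuous' t := by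
    rcases lt_or_ge t τ with h | h
    · refine (u.rightContinuous' t).congr_of_eventuallyEq ?_ (by simp [h])
      filter_upwards [mem_nhdsWithin_of_mem_nhds (Iio_mem_nhds h)] with r hr
      exact if_pos hr
    · have : ContinuousWithinAt (fun r => v (r - τ)) (Ici t) t :=
        (v.rightContinuous' (t - τ)).comp (f := fun r => r - τ)
          (by fun_prop) fun r (hr : t ≤ r) => tsub_le_tsub_right hr τ
      refine this.congr (fun r hr => ?_) (by simp [h.not_gt])
      exact if_neg (h.trans hr).not_gt
  leftLimit' t := by
    rcases le_or_gt t τ with h | h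
    · obtain ⟨l, hl⟩ := u.leftLimit' t
      refine ⟨l, hl.congr' ?_⟩
      filter_upwards [self_mem_nhdsWithin] with r hr
      exact (if_pos (lt_of_lt_of_le hr h)).symm
    · obtain ⟨l, hl⟩ := v.leftLimit' (t - τ)
      have : Tendsto (fun r : ℝ≥0 => r - τ) (𝓝[<] t) (𝓝[<] (t - τ)) := by
        refine tendsto_nhdsWithin_iff.2 ⟨?_, ?_⟩
        · exact (show Continuous fun r : ℝ≥0 => r - τ by fun_prop).continuousWithinAt
        · filter_upwards [self_mem_nhdsWithin,
            mem_nhdsWithin_of_mem_nhds (Ioi_mem_nhds h)] with r hr hr'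
          exact tsub_lt_tsub_right_of_le (le_of_lt hr') (mem_Iio.1 hr)
      refine ⟨l, (hl.comp this).congr' ?_⟩
      filter_upwards [mem_nhdsWithin_of_mem_nhds (Ioi_mem_nhds h)] with r hr
      exact (if_neg (not_lt.2 (le_of_lt hr))).symm
  finite_discontinuities' T := by
    refine (((u.finite_discontinuities' T).union (finite_singleton τ)).union
      ((v.finite_discontinuities' T).image fun r => r + τ)).subset ?_
    rintro t ⟨ht, hc⟩
    rcases lt_trichotomy t τ with h | h | h
    · refine Or.inl (Or.inl ⟨ht, fun hu => hc (hu.congr ?_)⟩)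
      filter_upwards [Iio_mem_nhds h] with r hr
      exact (if_pos hr).symm
    · exact Or.inl (Or.inr h)
    · refine Or.inr ⟨t - τ, ⟨tsub_le_self.trans ht, fun hv => hc ?_⟩, tsub_add_cancel_of_le h.le⟩
      have : ContinuousAt (fun r => v (r - τ)) t :=
        ContinuousAt.comp (f := fun r => r - τ) hv (by fun_prop)
      refine this.congr ?_
      filter_upwards [Ioi_mem_nhds h] with r hr
      exact (if_neg (not_lt.2 (le_of_lt hr))).symm

theorem norm_concat_le {τ : ℝ≥0} {u v : PCInput U} {s : ℝ} (hu : ‖u‖ ≤ s) (hv : ‖v‖ ≤ s) :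
    ‖concat τ u v‖ ≤ s := by
  refine (norm_le_iff _ _).2 fun t => ?_
  change ‖if t < τ then u t else v (t - τ)‖ ≤ s
  split_ifs
  · exact (u.norm_apply_le _).trans hu
  · exact (v.norm_apply_le _).trans hv

theorem concat_shift (τ : ℝ≥0) (u : PCInput U) : concat τ u (u.shift τ) = u := by
  refine toFun_injective (funext fun t => ?_)
  change (if t < τ then u t else u (t - τ + τ)) = u t
  split_ifs with h
  · rfl
  · rw [tsub_add_cancel_of_le (not_lt.1 h)]

end PCInput

/-! ### Concatenation of mild solutions -/

section Evolution

variable {X U : Type*} [NormedAddCommGroup X] [NormedSpace ℝ X] [NormedAddCommGroup U]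
  {T : C0Semigroup X} {f : X → U → X} {φ : ℝ≥0 → X → PCInput U → X}

/-- The integral is split at `τ`. On `[0, τ]` the semigroup law lets `T (t - τ)` be pulled out; on
`[τ, t]` a translation yields the integral for `z`. Integrands need to agree only on open intervals,
so the conventions at `τ` do not matter. -/
theorem IsMildSolution.concat [CompleteSpace X] {x₀ : X} {u v : PCInput U} {y z : ℝ≥0 → X}
    {τ : ℝ≥0} (hy : IsMildSolution T f x₀ u y) (hz : IsMildSolution T f (y τ) v z) :
    IsMildSolution T f x₀ (PCInput.concat τ u v)
      (fun t => if t ≤ τ then y t else z (t - τ)) := by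
  set w : ℝ≥0 → X := fun t => if t ≤ τ then y t else z (t - τ) with hw
  set G : ℝ → ℝ → X := fun t s =>
    T (t - s).toNNReal (f (w s.toNNReal) (PCInput.concat τ u v s.toNNReal)) with hG
  have hw0 : w 0 = y 0 := by simp [hw]
  have hleft : ∀ t : ℝ≥0, ∀ s ∈ Ioo (0 : ℝ) τ,
      G t s = T (t - s).toNNReal (f (y s.toNNReal) (u s.toNNReal)) := by
    intro t s hs
    have h : s.toNNReal < τ := (Real.toNNReal_lt_iff_lt_coe hs.1.le).2 hs.2
    have hc : PCInput.concat τ u v s.toNNReal = u s.toNNReal := if_pos h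
    simp only [hG, hc, hw, if_pos h.le]
  have hA : ∀ t : ℝ≥0, t ≤ τ → EqOn
      (fun s : ℝ => T (t - s).toNNReal (f (y s.toNNReal) (u s.toNNReal)))
      (G t) (uIoo 0 (t : ℝ)) := by
    intro t ht s hs
    rw [uIoo_of_le t.coe_nonneg] at hs
    exact (hleft t s ⟨hs.1, hs.2.trans_le (by exact_mod_cast ht)⟩).symm
  have hB : ∀ t : ℝ≥0, τ ≤ t → EqOn
      (fun s : ℝ => T (t - τ) (T (τ - s).toNNReal (f (y s.toNNReal) (u s.toNNReal))))
      (G t) (uIoo 0 (τ : ℝ)) := by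
    intro t ht s hs
    rw [uIoo_of_le τ.coe_nonneg] at hs
    simp only [hleft t s hs]
    have : ((t : ℝ) - s).toNNReal = (t - τ) + ((τ : ℝ) - s).toNNReal := by
      have h1 : ((t - τ : ℝ≥0) : ℝ) = t - τ := NNReal.coe_sub ht
      rw [← NNReal.coe_inj, NNReal.coe_add, h1, Real.coe_toNNReal _ (by linarith [hs.2]),
        Real.coe_toNNReal _ (by
          have : (τ : ℝ) ≤ t := by exact_mod_cast ht
          linarith [hs.2])]
      ring
    rw [this, T.map_add']
    rfl
  have hC : ∀ t : ℝ≥0, τ ≤ t → EqOn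
      (fun s => T (((t - τ : ℝ≥0) : ℝ) - (s - τ)).toNNReal
        (f (z (s - τ).toNNReal) (v (s - τ).toNNReal)))
      (G t) (uIoo (τ : ℝ) t) := by
    intro t ht s hs
    rw [uIoo_of_le (by exact_mod_cast ht)] at hs
    have hs0 : 0 ≤ s := τ.2.trans hs.1.le
    have h : τ < s.toNNReal := Real.lt_toNNReal_iff_coe_lt.2 hs.1
    have hc : PCInput.concat τ u v s.toNNReal = v (s.toNNReal - τ) := if_neg h.not_gt
    have h2 : (s - τ).toNNReal = s.toNNReal - τ := by
      rw [NNReal.sub_def, Real.coe_toNNReal _ hs0]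
    simp only [hG, hc, hw, if_neg h.not_ge, h2, NNReal.coe_sub ht, sub_sub_sub_cancel_right]
  have hI1 : ∀ t : ℝ≥0, τ ≤ t → IntervalIntegrable (G t) volume 0 τ := fun t ht => by
    have h := hy.integrable τ
    refine IntervalIntegrable.congr_uIoo ?_ (hB t ht)
    exact ⟨(T (t - τ)).integrable_comp h.1, (T (t - τ)).integrable_comp h.2⟩
  have hI2 : ∀ t : ℝ≥0, τ ≤ t → IntervalIntegrable (G t) volume τ t := fun t ht => by
    have h := (hz.integrable (t - τ)).comp_sub_right (τ : ℝ)
    rw [zero_add, NNReal.coe_sub ht, sub_add_cancel] at h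
    refine IntervalIntegrable.congr_uIoo ?_ (hC t ht)
    rwa [NNReal.coe_sub ht]
  refine ⟨?_, by rw [hw0, hy.initial], fun t => ?_, fun t => ?_⟩
  · refine Continuous.if_le hy.continuous (hz.continuous.comp (by fun_prop)) continuous_id
      continuous_const ?_
    rintro t rfl
    simp [hz.initial]
  · rcases le_total t τ with h | h
    · exact (hy.integrable t).congr_uIoo (hA t h)
    · exact (hI1 t h).trans (hI2 t h)
  · change w t = T t (w 0) + ∫ s in (0 : ℝ)..t, G t s
    rw [hw0]
    rcases le_total t τ with h | h
    · rw [← intervalIntegral.integral_congr_uIoo (hA t h), ← hy.integral_eq t]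
      exact if_pos h
    · have hwt : w t = z (t - τ) := by
        rcases h.eq_or_lt with rfl | h
        · simp [hw, hz.initial]
        · exact if_neg h.not_ge
      rw [← intervalIntegral.integral_add_adjacent_intervals (hI1 t h) (hI2 t h),
        ← intervalIntegral.integral_congr_uIoo (hB t h),
        ← intervalIntegral.integral_congr_uIoo (hC t h),
        ContinuousLinearMap.intervalIntegral_comp_comm _ (hy.integrable τ),
        intervalIntegral.integral_comp_sub_right (fun s => T (((t - τ : ℝ≥0) : ℝ) - s).toNNReal
          (f (z s.toNNReal) (v s.toNNReal))) (τ : ℝ), sub_self, ← NNReal.coe_sub h, hwt,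
        hz.integral_eq (t - τ), hz.initial, ← add_assoc]
      congr 1
      rw [hy.integral_eq τ, map_add]
      congr 1
      conv_rhs => rw [← tsub_add_cancel_of_le h, T.map_add']
      rfl

namespace IsMildFlow

theorem apply_zero (hφ : IsMildFlow T f φ) (x : X) (u : PCInput U) : φ 0 x u = x :=
  (hφ x u).1.initial

/-- The cocycle property: the glued trajectory is a mild solution, so uniqueness identifies it with
`φ`. -/
theorem apply_add_concat [CompleteSpace X] (hφ : IsMildFlow T f φ) (t τ : ℝ≥0) (x : X)
    (u v : PCInput U) : φ (t + τ) x (PCInput.concat τ u v) = φ t (φ τ x u) v := by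
  have h := congrFun ((hφ x (PCInput.concat τ u v)).2 _
    ((hφ x u).1.concat (τ := τ) (hφ (φ τ x u) v).1)) (t + τ)
  rw [← h]
  split_ifs with ht
  · obtain rfl : t = 0 := by simpa using ht
    simp [hφ.apply_zero]
  · simp

theorem apply_add [CompleteSpace X] (hφ : IsMildFlow T f φ) (t τ : ℝ≥0) (x : X)
    (u : PCInput U) : φ (t + τ) x u = φ t (φ τ x u) (u.shift τ) := by
  rw [← hφ.apply_add_concat, PCInput.concat_shift]

end IsMildFlow

/-! ### Lipschitz dependence on the initial value -/

theorem le_mul_exp_of_le_add_mul_integral {g : ℝ → ℝ} (hg : Continuous g) {a b τ : ℝ}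
    (hb : 0 < b) (h0 : ∀ t, 0 ≤ g t)
    (h : ∀ t ∈ Icc 0 τ, g t ≤ a + b * ∫ s in (0 : ℝ)..t, g s) :
    ∀ t ∈ Icc 0 τ, g t ≤ a * Real.exp (b * t) := by
  intro t ht
  have hd : ∀ t, HasDerivAt (fun t => ∫ s in (0 : ℝ)..t, g s) (g t) t := fun t =>
    intervalIntegral.integral_hasDerivAt_right (hg.intervalIntegrable _ _)
      (hg.stronglyMeasurableAtFilter _ _) hg.continuousAt
  -- Differential Gronwall, applied to the primitive of `g`, whose derivative `g` is at most `b`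
  -- times the primitive plus `a`.
  have key := norm_le_gronwallBound_of_norm_deriv_right_le
    (f := fun t => ∫ s in (0 : ℝ)..t, g s) (f' := g) (δ := 0) (K := b) (ε := a) (a := 0) (b := τ)
    (fun t _ => (hd t).continuousAt.continuousWithinAt) (fun t _ => (hd t).hasDerivWithinAt)
    (by simp) (fun t ht => by
      rw [Real.norm_of_nonneg (h0 t), Real.norm_of_nonneg
        (intervalIntegral.integral_nonneg ht.1 fun s _ => h0 s), add_comm]
      exact h t ⟨ht.1, ht.2.le⟩) t ht
  simp only [gronwallBound_of_K_ne_0 hb.ne', sub_zero, zero_mul, zero_add] at key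
  calc g t ≤ a + b * ∫ s in (0 : ℝ)..t, g s := h t ht
    _ ≤ a + b * (a / b * (Real.exp (b * t) - 1)) := by
        gcongr
        exact (le_abs_self _).trans key
    _ = a * Real.exp (b * t) := by field_simp; ring

theorem C0Semigroup.exists_norm_le [CompleteSpace X] (T : C0Semigroup X) (τ : ℝ≥0) :
    ∃ K : ℝ, 0 < K ∧ ∀ t ≤ τ, ‖T t‖ ≤ K := by
  obtain ⟨K, hK⟩ := banach_steinhaus (g := fun t : Iic τ => T t) fun x => by
    have hc : IsCompact (Iic τ) := by
      rw [← Icc_bot]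
      exact isCompact_Icc
    obtain ⟨C, hC⟩ := hc.exists_bound_of_continuousOn (T.continuous' x).continuousOn
    exact ⟨C, fun t => hC t t.2⟩
  exact ⟨max K 1, by positivity, fun t ht => (hK ⟨t, ht⟩).trans (le_max_left _ _)⟩

/-- BRS confines both trajectories to one ball up to time `τ`. There `f` has a single Lipschitz
constant, and Gronwall applies to the difference of the two integral equations. -/
theorem IsMildFlow.exists_lipschitz [CompleteSpace X] (hφ : IsMildFlow T f φ)
    (hLip : LipschitzOnBounded f) (hBRS : HasBRS φ) (C : ℝ) (τ : ℝ≥0) :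
    ∃ K : ℝ, 0 < K ∧ ∀ (x y : X) (u : PCInput U) (t : ℝ≥0), ‖x‖ ≤ C → ‖y‖ ≤ C → ‖u‖ ≤ C →
      t ≤ τ → ‖φ t x u - φ t y u‖ ≤ K * ‖x - y‖ := by
  obtain ⟨M, hM⟩ := hBRS (max C 1) (max τ 1) (by positivity) (by positivity)
  obtain ⟨L, hL, hLf⟩ := hLip (max M (max C 1)) (by positivity)
  obtain ⟨N, hN, hT⟩ := T.exists_norm_le τ
  refine ⟨N * Real.exp (N * L * τ), by positivity, fun x y u t hx hy hu ht => ?_⟩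
  set g : ℝ → ℝ := fun s => ‖φ s.toNNReal x u - φ s.toNNReal y u‖ with hg
  have hgc : Continuous g := (((hφ x u).1.continuous.comp continuous_real_toNNReal).sub
    ((hφ y u).1.continuous.comp continuous_real_toNNReal)).norm
  have hbound : ∀ z : X, ‖z‖ ≤ C → ∀ s ≤ τ, ‖φ s z u‖ ≤ max M (max C 1) := fun z hz s hs =>
    (hM z u s (hz.trans (le_max_left _ _)) (hu.trans (le_max_left _ _))
      (hs.trans (le_max_left _ _))).trans (le_max_left _ _)
  have key := le_mul_exp_of_le_add_mul_integral hgc (a := N * ‖x - y‖) (b := N * L) (τ := τ)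
    (by positivity) (fun _ => norm_nonneg _) (fun r hr => ?_) t ⟨t.2, by exact_mod_cast ht⟩
  · simp only [hg, Real.toNNReal_coe] at key
    calc _ ≤ _ := key
      _ ≤ N * ‖x - y‖ * Real.exp (N * L * τ) := by gcongr
      _ = _ := by ring
  · lift r to ℝ≥0 using hr.1
    have hrτ : r ≤ τ := by exact_mod_cast hr.2
    have e : φ r x u - φ r y u = T r (x - y) + ∫ s in (0 : ℝ)..r,
        (T (r - s).toNNReal (f (φ s.toNNReal x u) (u s.toNNReal)) -
          T (r - s).toNNReal (f (φ s.toNNReal y u) (u s.toNNReal))) := by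
      rw [intervalIntegral.integral_sub ((hφ x u).1.integrable r) ((hφ y u).1.integrable r),
        (hφ x u).1.integral_eq r, (hφ y u).1.integral_eq r, hφ.apply_zero, hφ.apply_zero, map_sub]
      abel
    simp only [hg, Real.toNNReal_coe]
    rw [e]
    refine (norm_add_le _ _).trans (add_le_add ?_ ?_)
    · exact ((T r).le_opNorm _).trans (by gcongr; exact hT r hrτ)
    · rw [← intervalIntegral.integral_const_mul]
      refine intervalIntegral.norm_integral_le_of_norm_le r.2 (ae_of_all _ fun s hs => ?_)
        ((hgc.const_mul _).intervalIntegrable _ _)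
      have hs' : s.toNNReal ≤ τ := (Real.toNNReal_le_iff_le_coe.2 hs.2).trans hrτ
      rw [← map_sub, mul_assoc]
      refine ((T _).le_opNorm _).trans ?_
      gcongr
      · refine hT _ (le_trans ?_ hrτ)
        rw [Real.toNNReal_le_iff_le_coe]
        linarith [hs.1]
      · exact hLf _ _ _ (hbound x hx _ hs') (hbound y hy _ hs')
          (((u.norm_apply_le _).trans hu).trans ((le_max_left _ _).trans (le_max_right _ _)))

end Evolution

/-! ### Construction of comparison functions -/

theorem exists_continuous_monotone_ge (M : ℕ → ℝ) : ∃ m : ℝ → ℝ, Continuous m ∧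
    MonotoneOn m (Ici 0) ∧ (∀ r, 0 ≤ r → 0 ≤ m r) ∧ ∀ r, 0 ≤ r → M ⌈r⌉₊ ≤ m r := by
  -- `N` is a monotone step function above `M ⌈r⌉₊`. Its integral over `[0, r + 1]` is continuous
  -- and dominates `N r` through the last unit interval.
  set N : ℝ → ℝ := fun r => ∑ k ∈ Finset.range (⌈r⌉₊ + 1), |M k| with hN
  have hmono : Monotone N := fun r r' h =>
    Finset.sum_le_sum_of_subset_of_nonneg
      (Finset.range_mono (Nat.succ_le_succ (Nat.ceil_mono h))) fun _ _ _ => abs_nonneg _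
  have hpos : ∀ r, 0 ≤ N r := fun r => Finset.sum_nonneg fun _ _ => abs_nonneg _
  have hint : ∀ a b, IntervalIntegrable N volume a b := fun a b => hmono.intervalIntegrable
  have hle : ∀ r, 0 ≤ r → N r ≤ ∫ s in (0 : ℝ)..r + 1, N s := fun r hr => by
    have h1 : ∫ s in r..r + 1, N r ≤ ∫ s in r..r + 1, N s :=
      intervalIntegral.integral_mono_on (by linarith) intervalIntegrable_const (hint _ _)
        fun s hs => hmono hs.1
    rw [intervalIntegral.integral_const, add_sub_cancel_left, one_smul] at h1
    have h2 : 0 ≤ ∫ s in (0 : ℝ)..r, N s := intervalIntegral.integral_nonneg hr fun s _ => hpos s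
    rw [← intervalIntegral.integral_add_adjacent_intervals (hint 0 r) (hint r (r + 1))]
    linarith
  refine ⟨fun r => ∫ s in (0 : ℝ)..r + 1, N s, ?_, fun r hr r' hr' h => ?_,
    fun r hr => (hpos r).trans (hle r hr), fun r hr => le_trans ?_ (hle r hr)⟩
  · exact (intervalIntegral.continuous_primitive hint 0).comp (continuous_add_const 1)
  · have := intervalIntegral.integral_nonneg (μ := volume) (add_le_add_left h 1)
      fun s _ => hpos s
    change ∫ s in (0 : ℝ)..r + 1, N s ≤ ∫ s in (0 : ℝ)..r' + 1, N s
    rw [← intervalIntegral.integral_add_adjacent_intervals (hint 0 (r + 1))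
      (hint (r + 1) (r' + 1))]
    linarith
  · exact (le_abs_self _).trans (Finset.single_le_sum (f := fun k => |M k|)
      (fun _ _ => abs_nonneg _) (Finset.mem_range.2 (Nat.lt_succ_self _)))

/-- A bound linear in `a i`, rather than mere boundedness, makes the comparison function vanish at
zero: it is `r` times a continuous monotone majorant of the slopes. The added `1` makes it strictly
increasing and unbounded. -/
theorem exists_isClassKInf_of_le_mul {ι : Type*} (p : ι → Prop) (a b : ι → ℝ)
    (ha : ∀ i, 0 ≤ a i) (h : ∀ n : ℕ, ∃ M : ℝ, ∀ i, p i → a i ≤ n → b i ≤ M * a i) :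
    ∃ κ, IsClassKInf κ ∧ ∀ i, p i → b i ≤ κ (a i) := by
  choose M hM using h
  obtain ⟨m, hm, hmono, hm0, hle⟩ := exists_continuous_monotone_ge M
  refine ⟨fun r => (m r + 1) * r, ⟨⟨by fun_prop, fun r hr r' hr' hlt => ?_, by simp⟩, ?_⟩,
    fun i hi => ?_⟩
  · have h1 := hmono hr hr' hlt.le
    have h2 := hm0 r hr
    have h3 : (0 : ℝ) ≤ r := hr
    exact mul_lt_mul_of_nonneg_of_pos' (by linarith) hlt h3 (by linarith)
  · rintro ⟨K, hK⟩
    have h1 := hK ⟨|K| + 1, mem_Ici.2 (by positivity), rfl⟩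
    have h2 := hm0 (|K| + 1) (by positivity)
    nlinarith [le_abs_self K, abs_nonneg K]
  · refine (hM ⌈a i⌉₊ i hi (Nat.le_ceil _)).trans ?_
    have := hle (a i) (ha i)
    exact mul_le_mul_of_nonneg_right (by linarith) (ha i)

theorem IsClassK.nonneg {κ : ℝ → ℝ} (hκ : IsClassK κ) {r : ℝ} (hr : 0 ≤ r) : 0 ≤ κ r := by
  rw [← hκ.map_zero]
  exact hκ.strictMonoOn.monotoneOn self_mem_Ici hr hr

theorem IsClassK.isClassKL_mul_exp_neg {κ : ℝ → ℝ} (hκ : IsClassK κ) :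
    IsClassKL fun r t => κ r * Real.exp (-t) where
  continuousOn := (hκ.continuousOn.comp continuousOn_fst fun _ h => h.1).mul
    (by fun_prop)
  classK t _ := ⟨hκ.continuousOn.mul continuousOn_const, fun _ hr _ hr' h =>
    mul_lt_mul_of_pos_right (hκ.strictMonoOn hr hr' h) (Real.exp_pos _), by simp [hκ.map_zero]⟩
  classL r hr := by
    have h0 : 0 < κ r := by
      rw [← hκ.map_zero]
      exact hκ.strictMonoOn self_mem_Ici hr.le hr
    refine ⟨by fun_prop, fun t _ t' _ h => ?_, ?_⟩
    · exact mul_lt_mul_of_pos_left (Real.exp_lt_exp.2 (neg_lt_neg h)) h0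
    · simpa using Real.tendsto_exp_neg_atTop_nhds_zero.const_mul (κ r)

/-! ### Distances to bounded sets -/

section Distance

variable {X : Type*} [NormedAddCommGroup X] {B : Set X} {R : ℝ}

theorem norm_le_infDist_add (hB : B.Nonempty) (hR : ∀ y ∈ B, ‖y‖ ≤ R) (x : X) :
    ‖x‖ ≤ Metric.infDist x B + R := by
  rw [← sub_le_iff_le_add, Metric.le_infDist hB]
  intro y hy
  rw [dist_eq_norm]
  linarith [hR y hy, norm_le_norm_sub_add x y]

theorem infDist_le_norm_add (hB : B.Nonempty) (hR : ∀ y ∈ B, ‖y‖ ≤ R) (x : X) :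
    Metric.infDist x B ≤ ‖x‖ + R := by
  obtain ⟨y, hy⟩ := hB
  refine (Metric.infDist_le_dist_of_mem hy).trans ?_
  rw [dist_eq_norm]
  linarith [hR y hy, norm_sub_le x y]

theorem infDist_cthickening [NormedSpace ℝ X] (hB : B.Nonempty) (δ : ℝ) (hδ : 0 ≤ δ) (x : X) :
    Metric.infDist x (Metric.cthickening δ B) = max (Metric.infDist x B - δ) 0 := by
  rw [Metric.infDist, infEDist_cthickening,
    ← ENNReal.ofReal_toReal (Metric.infEDist_ne_top hB), ← ENNReal.ofReal_sub _ hδ,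
    ENNReal.toReal_ofReal', Metric.infDist]

end Distance

/-! ### Reachable sets -/

section Reach

variable {X U : Type*} [NormedAddCommGroup X] [NormedAddCommGroup U]
  {φ : ℝ≥0 → X → PCInput U → X}

/-- The points reachable from `D` with inputs of norm at most `s`. -/
def reachSet (φ : ℝ≥0 → X → PCInput U → X) (D : Set X) (s : ℝ) : Set X :=
  {z | ∃ (t : ℝ≥0) (x : X) (u : PCInput U), x ∈ D ∧ ‖u‖ ≤ s ∧ φ t x u = z}

theorem PCInput.norm_zero_le {s : ℝ} (hs : 0 ≤ s) : ‖(PCInput.zero : PCInput U)‖ ≤ s :=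
  (PCInput.norm_le_iff _ _).2 fun t => by
    change ‖(0 : U)‖ ≤ s
    simpa using hs

theorem IsISSWrt.isISpSWrt {A : Set X} (h : IsISSWrt φ A) : IsISpSWrt φ A := by
  obtain ⟨β, γ, hβ, hγ, h⟩ := h
  exact ⟨β, γ, 1, hβ, hγ, one_pos, fun x u t => (h x u t).trans (by linarith)⟩

variable [NormedSpace ℝ X] {T : C0Semigroup X} {f : X → U → X}

namespace IsMildFlow

theorem subset_reachSet (hφ : IsMildFlow T f φ) (D : Set X) {s : ℝ} (hs : 0 ≤ s) :
    D ⊆ reachSet φ D s :=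
  fun x hx => ⟨0, x, PCInput.zero, hx, PCInput.norm_zero_le hs, hφ.apply_zero _ _⟩

theorem isSInvariant_reachSet [CompleteSpace X] (hφ : IsMildFlow T f φ) (D : Set X) (s : ℝ) :
    IsSInvariant φ s (reachSet φ D s) := by
  rintro t _ v ⟨τ, x, u, hx, hu, rfl⟩ hv
  exact ⟨t + τ, x, PCInput.concat τ u v, hx, PCInput.norm_concat_le hu hv,
    hφ.apply_add_concat t τ x u v⟩

/-- Every excursion from `D` stays in the BRS bound `M` up to time `τ`, by which it has returned.
Returns take at least unit time, so induction on an integer bound for `t` covers all times with the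
same `M`. -/
theorem isBounded_reachSet [CompleteSpace X] (hφ : IsMildFlow T f φ) (hBRS : HasBRS φ)
    {D : Set X} (hD : Bornology.IsBounded D) {s : ℝ} {τ : ℝ≥0}
    (hret : ∀ x ∈ D, ∀ u : PCInput U, ‖u‖ ≤ s → ∃ t ≤ τ, 1 ≤ t ∧ φ t x u ∈ D) :
    Bornology.IsBounded (reachSet φ D s) := by
  obtain ⟨R, hR⟩ := hD.exists_norm_le
  obtain ⟨M, hM⟩ := hBRS (max 1 (max R s)) (max 1 τ) (by positivity) (by positivity)
  have key : ∀ n : ℕ, ∀ t : ℝ≥0, t ≤ n → ∀ x ∈ D, ∀ u : PCInput U, ‖u‖ ≤ s →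
      ‖φ t x u‖ ≤ M := by
    intro n
    induction n with
    | zero =>
      intro t ht x hx u hu
      exact hM x u t (by simp [hR x hx]) (by simp [hu]) (ht.trans (by simp))
    | succ n ih =>
      intro t ht x hx u hu
      rcases le_total t τ with h | h
      · exact hM x u t (by simp [hR x hx]) (by simp [hu]) (by simp [h])
      · obtain ⟨r, hrτ, hr1, hrD⟩ := hret x hx u hu
        have hrt : r ≤ t := hrτ.trans h
        rw [← tsub_add_cancel_of_le hrt, hφ.apply_add]
        refine ih _ ?_ _ hrD _ ((PCInput.norm_shift_le _ _).trans hu)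
        rw [tsub_le_iff_right]
        push_cast at ht
        exact ht.trans (by gcongr)
  refine isBounded_iff_forall_norm_le.2 ⟨M, ?_⟩
  rintro _ ⟨t, x, u, hx, hu, rfl⟩
  exact key ⌈t⌉₊ t (Nat.le_ceil t) x hx u hu

/-- The gain in ULIM enters the target set and not the hitting time, so `τ` depends on `r` alone and
serves every input and every `s` at once. -/
theorem exists_absorbing [CompleteSpace X] (hφ : IsMildFlow T f φ) (hBRS : HasBRS φ)
    {A : Set X} (hA : A.Nonempty) (hAb : Bornology.IsBounded A) (hU : IsULIMWrt φ A) :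
    ∃ B : ℝ → Set X, (∀ s, 0 ≤ s → (B s).Nonempty ∧ Bornology.IsBounded (B s) ∧
      IsSInvariant φ s (B s)) ∧ ∀ r : ℝ, ∃ τ : ℝ≥0, ∀ (x : X) (u : PCInput U) (t : ℝ≥0),
        ‖x‖ ≤ r → τ ≤ t → ∀ s, ‖u‖ ≤ s → φ t x u ∈ B s := by
  obtain ⟨γ, hγ, hU⟩ := hU
  obtain ⟨R, hR⟩ := hAb.exists_norm_le
  set D : ℝ → Set X := fun s => {x | Metric.infDist x A ≤ 1 + γ s} with hD
  have hlim : ∀ r : ℝ, ∃ τ : ℝ≥0, ∀ (x : X) (u : PCInput U), ‖x‖ ≤ r → ∀ s, ‖u‖ ≤ s →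
      ∃ t ≤ τ, φ t x u ∈ D s := by
    intro r
    obtain ⟨τ, hτ⟩ := hU 1 (max 1 (r + R)) one_pos (by positivity)
    refine ⟨τ, fun x u hx s hs => ?_⟩
    obtain ⟨t, ht, h⟩ := hτ u x ((infDist_le_norm_add hA hR x).trans
      ((add_le_add_left hx R).trans (le_max_right _ _)))
    refine ⟨t, ht, h.trans (add_le_add_right ?_ 1)⟩
    exact hγ.strictMonoOn.monotoneOn u.norm_nonneg (u.norm_nonneg.trans hs) hs
  have hDb : ∀ s, Bornology.IsBounded (D s) := fun s =>
    isBounded_iff_forall_norm_le.2 ⟨1 + γ s + R, fun x hx =>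
      (norm_le_infDist_add hA hR x).trans (add_le_add_left hx R)⟩
  refine ⟨fun s => reachSet φ (D s) s, fun s hs => ⟨?_, ?_, hφ.isSInvariant_reachSet _ _⟩,
    fun r => ?_⟩
  · refine Set.Nonempty.mono (hφ.subset_reachSet _ hs) (hA.mono fun x hx => ?_)
    have := hγ.nonneg hs
    simp only [hD, mem_ofPred_eq, Metric.infDist_zero_of_mem hx]
    linarith
  · obtain ⟨C, hC⟩ := (hDb s).exists_norm_le
    -- Running for unit time first, which leads into the ball of radius `M`, makes the return time
    -- at least `1`.
    obtain ⟨M, hM⟩ := hBRS (max 1 (max C s)) 1 (by positivity) one_pos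
    obtain ⟨τ, hτ⟩ := hlim M
    refine hφ.isBounded_reachSet hBRS (hDb s) (τ := τ + 1) fun x hx u hu => ?_
    obtain ⟨t, ht, h⟩ := hτ (φ 1 x u) (u.shift 1)
      (hM x u 1 (by simp [hC x hx]) (by simp [hu]) le_rfl) s ((PCInput.norm_shift_le _ _).trans hu)
    exact ⟨t + 1, by gcongr, by simp, by rwa [hφ.apply_add]⟩
  · obtain ⟨τ, hτ⟩ := hlim r
    refine ⟨τ, fun x u t hx ht s hs => ?_⟩
    obtain ⟨t₀, ht₀, h⟩ := hτ x u hx s hs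
    rw [← tsub_add_cancel_of_le (ht₀.trans ht), hφ.apply_add]
    exact hφ.isSInvariant_reachSet _ _ _ _ _ (hφ.subset_reachSet _ (u.norm_nonneg.trans hs) h)
      ((PCInput.norm_shift_le _ _).trans hs)

theorem exists_iss_invariant [CompleteSpace X] (hφ : IsMildFlow T f φ)
    (hLip : LipschitzOnBounded f) (hBRS : HasBRS φ)
    {A : Set X} (hA : A.Nonempty) (hAb : Bornology.IsBounded A) (hU : IsULIMWrt φ A)
    {s : ℝ} (hs : 0 < s) : ∃ B : Set X, B.Nonempty ∧ Bornology.IsBounded B ∧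
      IsSInvariant φ s B ∧ IsISSWrt φ B := by
  obtain ⟨B', hB', habs⟩ := hφ.exists_absorbing hBRS hA hAb hU
  obtain ⟨hB, hBb, hinv⟩ := hB' s hs.le
  set B := B' s
  refine ⟨B, hB, hBb, hinv, ?_⟩
  obtain ⟨R, hR⟩ := hBb.exists_norm_le
  -- If the trajectory is already absorbed, boundedness of `B' n` applies. Otherwise `x` lies in a
  -- fixed ball and `t` is at most its absorption time, so BRS applies.
  have hall : ∀ n : ℕ, ∃ G : ℝ, 0 ≤ G ∧ ∀ (x : X) (u : PCInput U) (t : ℝ≥0),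
      ‖u‖ ≤ n → (Metric.infDist x B ≤ n ∨ ∀ q, ‖u‖ ≤ q → φ t x u ∈ B' q) →
        Metric.infDist (φ t x u) B ≤ G := by
    intro n
    obtain ⟨τ, hτ⟩ := habs (n + R)
    obtain ⟨M, hM⟩ := hBRS (max 1 (max n (n + R))) (max 1 τ) (by positivity) (by positivity)
    obtain ⟨C, hC⟩ := (hB' n n.cast_nonneg).2.1.exists_norm_le
    refine ⟨max 0 (max M C + R), le_max_left _ _, fun x u t hu h => le_max_of_le_right ?_⟩
    refine (infDist_le_norm_add hB hR _).trans (add_le_add_left ?_ R)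
    by_cases h' : ∀ q, ‖u‖ ≤ q → φ t x u ∈ B' q
    · exact le_max_of_le_right (hC _ (h' n hu))
    · have hx : ‖x‖ ≤ n + R := (norm_le_infDist_add hB hR x).trans
        (add_le_add_left (h.resolve_right h') R)
      refine le_max_of_le_left (hM x u t (by simp [hx]) (by simp [hu]) ?_)
      exact le_max_of_le_right (not_lt.1 fun ht => h' (hτ x u t hx ht.le))
  -- The case `p` is paid for by the gain `γ`. In the case `¬ p`, either the input has norm at most
  -- `s`, or the initial distance exceeds the input norm, hence `s`, and the trajectory is not yet
  -- absorbed; this is paid for by `β`.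
  let p : X × PCInput U × ℝ≥0 → Prop := fun i => s < ‖i.2.1‖ ∧
    (Metric.infDist i.1 B ≤ ‖i.2.1‖ ∨ ∀ q, ‖i.2.1‖ ≤ q → φ i.2.2 i.1 i.2.1 ∈ B' q)
  obtain ⟨γ, hγ, hγle⟩ := exists_isClassKInf_of_le_mul p (fun i => ‖i.2.1‖)
    (fun i => Metric.infDist (φ i.2.2 i.1 i.2.1) B) (fun i => i.2.1.norm_nonneg) fun n => by
      obtain ⟨G, hG, hGle⟩ := hall n
      refine ⟨G / s, ?_⟩
      rintro ⟨x, u, t⟩ ⟨hsu, h⟩ hun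
      calc Metric.infDist (φ t x u) B ≤ G := hGle x u t hun (h.imp_left fun h => h.trans hun)
        _ = G / s * s := by field_simp
        _ ≤ G / s * ‖u‖ := by gcongr
  obtain ⟨κ, hκ, hκle⟩ := exists_isClassKInf_of_le_mul (fun i => ¬ p i)
    (fun i => Metric.infDist i.1 B)
    (fun i => Metric.infDist (φ i.2.2 i.1 i.2.1) B * Real.exp i.2.2)
    (fun i => Metric.infDist_nonneg) fun n => by
      obtain ⟨G, hG, hGle⟩ := hall n
      obtain ⟨τ, hτ⟩ := habs (n + R)
      obtain ⟨K, hK, hKle⟩ := hφ.exists_lipschitz hLip hBRS (max s (max R (n + R))) τ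
      -- `K` serves small inputs and `G / s` large ones. The distance can be nonzero only for `t ≤
      -- τ`, so the factor `exp τ` makes up for `exp t`.
      refine ⟨(K + G / s) * Real.exp τ, ?_⟩
      rintro ⟨x, u, t⟩ hp hxn
      change Metric.infDist x B ≤ n at hxn
      change Metric.infDist (φ t x u) B * Real.exp t ≤
        (K + G / s) * Real.exp τ * Metric.infDist x B
      have hx : ‖x‖ ≤ n + R := (norm_le_infDist_add hB hR x).trans (add_le_add_left hxn R)
      have h0 : 0 ≤ Metric.infDist x B := Metric.infDist_nonneg
      suffices h : Metric.infDist (φ t x u) B = 0 ∨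
          t ≤ τ ∧ Metric.infDist (φ t x u) B ≤ (K + G / s) * Metric.infDist x B by
        rcases h with h | ⟨ht, h⟩
        · rw [h, zero_mul]
          positivity
        · rw [mul_right_comm]
          gcongr
      rcases le_or_gt ‖u‖ s with hu | hu
      · rcases le_total τ t with ht | ht
        · exact Or.inl (Metric.infDist_zero_of_mem (hτ x u t hx ht s hu))
        · refine Or.inr ⟨ht, ?_⟩
          -- Invariance keeps the trajectory from any `y ∈ B` in `B`, so it bounds the distance;
          -- dividing by `K` allows the infimum over `y` without a nearest point.
          have : Metric.infDist (φ t x u) B / K ≤ Metric.infDist x B := by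
            rw [Metric.le_infDist hB]
            intro y hy
            rw [div_le_iff₀' hK, dist_eq_norm]
            refine (Metric.infDist_le_dist_of_mem (hinv t y u hy hu)).trans ?_
            rw [dist_eq_norm]
            exact hKle x y u t (by simp [hx])
              ((hR y hy).trans ((le_max_left _ _).trans (le_max_right _ _))) (by simp [hu]) ht
          rw [div_le_iff₀' hK] at this
          refine this.trans ?_
          gcongr
          exact le_add_of_nonneg_right (by positivity)
      · have hp' : ‖u‖ < Metric.infDist x B ∧ ¬ ∀ q, ‖u‖ ≤ q → φ t x u ∈ B' q := by
          simpa [p, hu] using hp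
        refine Or.inr ⟨not_lt.1 fun ht => hp'.2 (hτ x u t hx ht.le), ?_⟩
        calc Metric.infDist (φ t x u) B ≤ G := hGle x u t (hp'.1.le.trans hxn) (Or.inl hxn)
          _ = G / s * s := by field_simp
          _ ≤ G / s * Metric.infDist x B := by
              gcongr
              exact (hu.trans hp'.1).le
          _ ≤ _ := by
              gcongr
              exact le_add_of_nonneg_left hK.le
  refine ⟨fun r t => κ r * Real.exp (-t), γ, hκ.toIsClassK.isClassKL_mul_exp_neg, hγ,
    fun x u t => ?_⟩
  have h1 : 0 ≤ κ (Metric.infDist x B) := hκ.nonneg Metric.infDist_nonneg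
  have h2 : 0 ≤ γ ‖u‖ := hγ.nonneg u.norm_nonneg
  change Metric.infDist (φ t x u) B ≤ κ (Metric.infDist x B) * Real.exp (-t) + γ ‖u‖
  by_cases h : p (x, u, t)
  · have h3 : Metric.infDist (φ t x u) B ≤ γ ‖u‖ := hγle (x, u, t) h
    have h4 := mul_nonneg h1 (Real.exp_pos (-(t : ℝ))).le
    linarith
  · have h3 : Metric.infDist (φ t x u) B * Real.exp t ≤ κ (Metric.infDist x B) :=
      hκle (x, u, t) h
    rw [← le_div_iff₀ (Real.exp_pos _), div_eq_mul_inv, ← Real.exp_neg] at h3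
    linarith

end IsMildFlow

/-! ### The uniform limit property from practical stability -/

theorem IsISpSWrt.isULIMWrt_cthickening {A : Set X} (hA : A.Nonempty) (h : IsISpSWrt φ A) :
    ∃ c, IsULIMWrt φ (Metric.cthickening c A) := by
  obtain ⟨β, γ, c, hβ, hγ, hc, h⟩ := h
  refine ⟨c, γ, hγ, fun ε r hε hr => ?_⟩
  -- Distance `r` from the thickened set means distance at most `r + c` from `A`, hence `τ` is
  -- chosen with `β (r + c) τ < ε`.
  have hrc : 0 < r + c := by positivity
  obtain ⟨τ, hτ⟩ := (((hβ.classL (r + c) hrc).tendsto_zero.eventually (gt_mem_nhds hε)).and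
    (eventually_ge_atTop 0)).exists
  lift τ to ℝ≥0 using hτ.2
  refine ⟨τ, fun u x hx => ⟨τ, le_rfl, ?_⟩⟩
  rw [infDist_cthickening hA c hc.le] at hx ⊢
  have hx' : Metric.infDist x A ≤ r + c := by linarith [le_max_left (Metric.infDist x A - c) 0]
  have h1 := (hβ.classK τ τ.2).strictMonoOn.monotoneOn (Metric.infDist_nonneg (x := x) (s := A))
    hrc.le hx'
  have h2 := hγ.nonneg u.norm_nonneg
  refine max_le ?_ (by positivity)
  linarith [h x u τ, hτ.1]

end Reach

theorem mainTheorem5 {X U : Type*} [NormedAddCommGroup X] [NormedSpace ℝ X] [CompleteSpace X]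
    [NormedAddCommGroup U] [NormedSpace ℝ U]
    (A : X →ₗ.[ℝ] X) (T : C0Semigroup X) (hA : T.IsGenerator A)
    (f : X → U → X) (hLip : LipschitzOnBounded f) (hcont : ∀ x, Continuous (f x))
    (φ : ℝ≥0 → X → PCInput U → X) (hφ : IsMildFlow T f φ) (hBRS : HasBRS φ) :
    List.TFAE
      [IsISpS φ,
       ∀ s : ℝ, 0 < s → ∃ B : Set X, B.Nonempty ∧ Bornology.IsBounded B ∧
         IsSInvariant φ s B ∧ IsISSWrt φ B,
       ∃ B : Set X, B.Nonempty ∧ Bornology.IsBounded B ∧ IsULIMWrt φ B] := by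
  tfae_have 1 → 3 := by
    rintro ⟨B, hB, hBb, h⟩
    obtain ⟨c, hc⟩ := h.isULIMWrt_cthickening hB
    exact ⟨Metric.cthickening c B, hB.mono (Metric.self_subset_cthickening B),
      hBb.cthickening, hc⟩
  tfae_have 3 → 2 := by
    rintro ⟨B, hB, hBb, h⟩ s hs
    exact hφ.exists_iss_invariant hLip hBRS hB hBb h hs
  tfae_have 2 → 1 := by
    intro h
    obtain ⟨B, hB, hBb, -, h⟩ := h 1 one_pos
    exact ⟨B, hB, hBb, h.isISpSWrt⟩
  tfae_finish
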